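/- All graphs are finite, simple and undirected. Let $r,t,\ell\ge 0$ be integers, let $H$ be a graph of treewidth at most $t$, let $P$ be a path (with at least one vertex), and let $G$ be an $r$-shallow minor of the strong product $H\boxtimes P\boxtimes K_\ell$; that is, one can assign to each vertex $v$ of $G$ a connected subgraph $\mu(v)$ of $H\boxtimes P\boxtimes K_\ell$ of radius at most $r$, such that $\mu(v)$ and $\mu(w)$ are vertex-disjoint for distinct $v,w\in V(G)$, and for every edge $vw$ of $G$ some edge of $H\boxtimes P\boxtimes K_\ell$ joins a vertex of $\mu(v)$ to a vertex of $\mu(w)$. Then there is a graph $J$ with treewidth at most $\binom{2r+1+t}{t}-1$ such that $G$ is isomorphic to a subgraph of $J\boxtimes P\boxtimes K_{\ell(2r+1)^2}$ (with the same path $P$). Moreover, $$\mathrm{rtw}(G)\le \binom{2r+1+t}{t}\,\ell(2r+1)^2-1,$$ where the row treewidth $\mathrm{rtw}(G)$ is the minimum treewidth of a graph $H'$ such that $G$ is isomorphic to a subgraph of $H'\boxtimes P'$ for some path $P'$. (The graph with no vertices has treewidth $-1$.) -/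

import Mathlib

namespace SimpleGraph

/-- The strong product of two graphs. -/
def strongProd {α β : Type*} (G : SimpleGraph α) (H : SimpleGraph β) : SimpleGraph (α × β) where
  Adj x y := (G.Adj x.1 y.1 ∧ (x.2 = y.2 ∨ H.Adj x.2 y.2)) ∨ (x.1 = y.1 ∧ H.Adj x.2 y.2)
  symm := ⟨by
    rintro x y (⟨h, h' | h'⟩ | ⟨h, h'⟩)
    · exact Or.inl ⟨h.symm, Or.inl h'.symm⟩
    · exact Or.inl ⟨h.symm, Or.inr h'.symm⟩
    · exact Or.inr ⟨h.symm, h'.symm⟩⟩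
  loopless := ⟨by
    rintro x (⟨h, -⟩ | ⟨-, h⟩)
    · exact G.irrefl h
    · exact H.irrefl h⟩

/-- `P` is a path: it is isomorphic to the path on `n + 1` vertices for some `n ≥ 0`. -/
def IsPathGraph {β : Type*} (P : SimpleGraph β) : Prop :=
  ∃ n : ℕ, Nonempty (P ≃g pathGraph (n + 1))

/-- A tree-decomposition of `G` indexed by the tree `T`. An induced subgraph of a tree is a
non-empty subtree exactly when it is connected (in Mathlib, connected graphs are non-empty). -/
structure TreeDecomposition {V ι : Type*} (G : SimpleGraph V) (T : SimpleGraph ι) where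
  isTree : T.IsTree
  bag : ι → Finset V
  connected_bags : ∀ v : V, (T.induce {x | v ∈ bag x}).Connected
  exists_bag_of_adj : ∀ u v : V, G.Adj u v → ∃ x, u ∈ bag x ∧ v ∈ bag x

/-- The width of a tree-decomposition: the largest size of a bag, minus one. It is an integer, and
equals `-1` when all bags are empty. -/
def TreeDecomposition.width {V ι : Type*} [Fintype ι] {G : SimpleGraph V} {T : SimpleGraph ι}
    (D : TreeDecomposition G T) : ℤ :=
  ((Finset.univ.sup fun x => (D.bag x).card : ℕ) : ℤ) - 1

/-- The treewidth of a finite graph: the minimum width of a tree-decomposition of `G` indexed by a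
finite tree. All widths are at least `-1`, and a finite graph has a tree-decomposition (with a
single bag), so that the infimum is a minimum. The graph without vertices has treewidth `-1`. -/
noncomputable def treewidth {V : Type*} (G : SimpleGraph V) : ℤ :=
  sInf {w : ℤ | ∃ (ι : Type) (_ : Fintype ι) (T : SimpleGraph ι) (D : TreeDecomposition G T),
    D.width = w}

/-- The row treewidth of a finite graph `G`: the minimum treewidth of a finite graph `H` such that
`G` is contained in the strong product of `H` and a path. -/
noncomputable def rowTreewidth {V : Type*} (G : SimpleGraph V) : ℤ :=
  sInf {w : ℤ | ∃ (α : Type) (_ : Finite α) (H : SimpleGraph α) (β : Type) (P : SimpleGraph β),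
    P.IsPathGraph ∧ G.IsContained (H.strongProd P) ∧ H.treewidth = w}

/-- `μ` is a model of `H` in `G`. -/
structure IsModel {V W : Type*} (H : SimpleGraph W) (G : SimpleGraph V) (μ : W → G.Subgraph) :
    Prop where
  connected : ∀ v : W, (μ v).Connected
  disjoint : ∀ v w : W, v ≠ w → Disjoint (μ v).verts (μ w).verts
  adjacent : ∀ v w : W, H.Adj v w → ∃ a ∈ (μ v).verts, ∃ b ∈ (μ w).verts, G.Adj a b

/-- `H` is an `r`-shallow minor of `G`: there is a model of `H` in `G` each of whose branch sets
is a subgraph of radius at most `r` (the radius being measured in that subgraph). -/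
def IsShallowMinor {V W : Type*} (r : ℕ) (H : SimpleGraph W) (G : SimpleGraph V) : Prop :=
  ∃ μ : W → G.Subgraph, IsModel H G μ ∧ ∀ v : W, (μ v).coe.radius ≤ (r : ℕ∞)

end SimpleGraph

/-! A tree-decomposition of `H` yields a chordal completion and a vertex order in which every vertex
has at most `t` smaller neighbours, collected in `B`. Represent each branch set by a vertex with
least `H`-coordinate. For an edge of `G`, some vertex reaches the coordinates of both
representatives by walks of at most `2r+1` steps that stay weakly above their targets; chordality
turns such walks into descents through `B` (`exists_descend_of_adj_branchSets`). Let `J` join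
vertices lying in a common set `descend B (2r+1) y`. These sets are the bags of a tree-decomposition
of `J` (`IsElimination.exists_parent`, `treewidth_le_of_bags`), and Pascal's rule bounds their size
(`IsElimination.card_descend_le`).

The two representatives are also at distance at most `4r+1`. Cut `P` into intervals of length
`(2r+1)^2`: the interval index is again a vertex of `P`, and the offset goes into the complete
factor. For row treewidth, the complete factor is absorbed into `J`. -/

namespace SimpleGraph

/-! ### Descending reachability in elimination orders. -/

section Elimination

variable {α : Type*} [LinearOrder α]

/-- `B` assigns to each vertex its set of smaller neighbours in a chordal graph for which the
given linear order is a perfect elimination order. -/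
structure IsElimination (B : α → Finset α) : Prop where
  lt : ∀ i, ∀ j ∈ B i, j < i
  chordal : ∀ i, ∀ j ∈ B i, ∀ k ∈ B i, j < k → j ∈ B k

/-- The vertices reachable from `y` in at most `s` steps, each from a vertex `u` to a member
of `B u`. -/
def descend (B : α → Finset α) : ℕ → α → Finset α
  | 0, y => {y}
  | s + 1, y => insert y ((B y).biUnion (descend B s))

variable {B : α → Finset α}

theorem mem_descend_succ {s : ℕ} {y z : α} :
    z ∈ descend B (s + 1) y ↔ z = y ∨ ∃ c ∈ B y, z ∈ descend B s c := by
  simp [descend]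

theorem self_mem_descend (s : ℕ) (y : α) : y ∈ descend B s y := by
  cases s <;> simp [descend]

theorem descend_subset_succ (s : ℕ) (y : α) : descend B s y ⊆ descend B (s + 1) y := by
  induction s generalizing y with
  | zero => intro z hz; simp_all [descend]
  | succ s ih =>
    intro z hz
    rw [mem_descend_succ] at hz ⊢
    rcases hz with h | ⟨c, hc, hz⟩
    · exact Or.inl h
    · exact Or.inr ⟨c, hc, ih c hz⟩

theorem descend_mono {s s' : ℕ} (h : s ≤ s') (y : α) : descend B s y ⊆ descend B s' y :=
  monotone_nat_of_le_succ (f := fun s => descend B s y) (fun s => descend_subset_succ s y) h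

/-- While a descent from `x` stays above `y`, chordality keeps `y` in the set `B` of its current
vertex. When it first drops to `y` or below, that step can be made from `y` itself or skipped. -/
theorem IsElimination.mem_descend_of_mem (hB : IsElimination B) {s : ℕ} {x y z : α}
    (hy : y ∈ B x) (hz : z ∈ descend B s x) (hzy : z ≤ y) : z ∈ descend B s y := by
  induction s generalizing x with
  | zero =>
    simp only [descend, Finset.mem_singleton] at hz
    exact absurd (hB.lt _ _ hy) (not_lt.2 (hz ▸ hzy))
  | succ s ih =>
    rcases mem_descend_succ.1 hz with rfl | ⟨c, hc, hz⟩
    · exact absurd (hB.lt _ _ hy) (not_lt.2 hzy)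
    · rcases lt_trichotomy c y with h | rfl | h
      · exact mem_descend_succ.2 (Or.inr ⟨c, hB.chordal _ _ hc _ hy h, hz⟩)
      · exact descend_subset_succ _ _ hz
      · exact descend_subset_succ _ _ (ih (hB.chordal _ _ hy _ hc h) hz)

/-- Vertices weakly reachable in one more step are reachable by descending. -/
theorem IsElimination.mem_descend_succ_of_adj (hB : IsElimination B) {s : ℕ} {x y z : α}
    (hxy : x = y ∨ x ∈ B y ∨ y ∈ B x) (hz : z ∈ descend B s x) (hzy : z ≤ y) :
    z ∈ descend B (s + 1) y := by
  rcases hxy with rfl | h | h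
  · exact descend_subset_succ _ _ hz
  · exact mem_descend_succ.2 (Or.inr ⟨x, h, hz⟩)
  · exact descend_subset_succ _ _ (hB.mem_descend_of_mem h hz hzy)

/-- The parent is the largest member of `B y`: by chordality its own `B` contains all the others. -/
theorem IsElimination.exists_parent (hB : IsElimination B) (s : ℕ) (y : α) :
    descend B s y = {y} ∨ ∃ p < y, ∀ z ∈ descend B s y, z ≠ y → z ∈ descend B s p := by
  cases s with
  | zero => simp [descend]
  | succ s =>
    rcases (B y).eq_empty_or_nonempty with h | h
    · simp [descend, h]
    · refine Or.inr ⟨(B y).max' h, hB.lt _ _ ((B y).max'_mem h), fun z hz hzy => ?_⟩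
      obtain ⟨c, hc, hz⟩ := (mem_descend_succ.1 hz).resolve_left hzy
      rcases ((B y).le_max' c hc).lt_or_eq with h' | h'
      · exact mem_descend_succ.2
          (Or.inr ⟨c, hB.chordal _ _ hc _ ((B y).max'_mem h) h', hz⟩)
      · exact descend_subset_succ _ _ (h' ▸ hz)

/-- The elimination structure on the higher neighbours of `b`. -/
def restrictAbove (B : α → Finset α) (b : α) (u : α) : Finset α :=
  -- The empty default keeps the size bound where `b ∉ B u`, since filtering need not remove
  -- anything there.
  if b ∈ B u then (B u).filter (b < ·) else ∅

theorem mem_restrictAbove {b u c : α} :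
    c ∈ restrictAbove B b u ↔ b ∈ B u ∧ c ∈ B u ∧ b < c := by
  unfold restrictAbove
  split_ifs with h <;> simp [h]

theorem IsElimination.restrictAbove (hB : IsElimination B) (b : α) :
    IsElimination (restrictAbove B b) where
  lt i j hj := hB.lt _ _ (mem_restrictAbove.1 hj).2.1
  chordal i j hj k hk hjk := by
    rw [mem_restrictAbove] at hj hk ⊢
    exact ⟨hB.chordal _ _ hj.1 _ hk.2.1 hk.2.2, hB.chordal _ _ hj.2.1 _ hk.2.1 hjk, hj.2.2⟩

theorem card_restrictAbove_le {t : ℕ} {b u : α} (h : (B u).card ≤ t + 1) :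
    (SimpleGraph.restrictAbove B b u).card ≤ t := by
  have : b ∈ B u → (SimpleGraph.restrictAbove B b u).card < (B u).card := fun hb =>
    Finset.card_lt_card ⟨fun c hc => (mem_restrictAbove.1 hc).2.1, fun hs =>
      lt_irrefl _ (mem_restrictAbove.1 (hs hb)).2.2⟩
  by_cases hb : b ∈ B u
  · have := this hb; omega
  · simp [SimpleGraph.restrictAbove, hb]

theorem IsElimination.descend_subset_union (hB : IsElimination B) {b u : α} (hb : b ∈ B u)
    (s : ℕ) : descend B s u ⊆ descend (SimpleGraph.restrictAbove B b) s u ∪ descend B s b := by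
  induction s generalizing u with
  | zero => simp [descend]
  | succ s ih =>
    intro z hz
    rw [Finset.mem_union]
    rcases mem_descend_succ.1 hz with rfl | ⟨c, hc, hz⟩
    · exact Or.inl (self_mem_descend _ _)
    · rcases lt_trichotomy c b with h | rfl | h
      · exact Or.inr (mem_descend_succ.2 (Or.inr ⟨c, hB.chordal _ _ hc _ hb h, hz⟩))
      · exact Or.inr (descend_subset_succ _ _ hz)
      · rcases Finset.mem_union.1 (ih (hB.chordal _ _ hb _ hc h) hz) with hz | hz
        · exact Or.inl (mem_descend_succ.2 (Or.inr ⟨c, mem_restrictAbove.2 ⟨hb, hc, h⟩, hz⟩))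
        · exact Or.inr (descend_subset_succ _ _ hz)

/-- Minimality of `b` means the first step cannot go below `b`, so a descent that leaves the part
above `b` has a step to spare. -/
theorem IsElimination.descend_succ_subset_union (hB : IsElimination B) {b y : α} (hb : b ∈ B y)
    (hmin : ∀ c ∈ B y, b ≤ c) (s : ℕ) :
    descend B (s + 1) y ⊆
      descend (SimpleGraph.restrictAbove B b) (s + 1) y ∪ descend B s b := by
  intro z hz
  rw [Finset.mem_union]
  rcases mem_descend_succ.1 hz with rfl | ⟨c, hc, hz⟩
  · exact Or.inl (self_mem_descend _ _)
  · rcases (hmin c hc).eq_or_lt with rfl | h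
    · exact Or.inr hz
    · rcases Finset.mem_union.1
        (hB.descend_subset_union (hB.chordal _ _ hb _ hc h) s hz) with hz | hz
      · exact Or.inl (mem_descend_succ.2 (Or.inr ⟨c, mem_restrictAbove.2 ⟨hb, hc, h⟩, hz⟩))
      · exact Or.inr hz

/-- Splitting at the least `b ∈ B y` gives Pascal's recurrence: above `b` the parameter `t` drops by
one, from `b` the number of steps does. -/
theorem IsElimination.card_descend_le {t : ℕ} (hB : IsElimination B) (ht : ∀ u, (B u).card ≤ t)
    (s : ℕ) (y : α) : (descend B s y).card ≤ (s + t).choose t := by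
  induction t generalizing B s y with
  | zero =>
    have : B y = ∅ := Finset.card_eq_zero.1 (Nat.le_zero.1 (ht y))
    cases s <;> simp [descend, this]
  | succ t iht =>
    induction s generalizing y with
    | zero => simp [descend]
    | succ s ihs =>
      rcases (B y).eq_empty_or_nonempty with h | h
      · simpa [descend, h] using
          Nat.succ_le_of_lt (Nat.choose_pos (Nat.le_add_left (t + 1) (s + 1)))
      · have hb := (B y).min'_mem h
        have h1 := iht (hB.restrictAbove ((B y).min' h))
          (fun u => card_restrictAbove_le (ht u)) (s + 1) y
        have h2 := ihs ((B y).min' h)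
        have h3 := Finset.card_le_card
          (hB.descend_succ_subset_union hb (fun c hc => (B y).min'_le c hc) s)
        have h4 := h3.trans (Finset.card_union_le _ _)
        have h5 : (s + 1 + (t + 1)).choose (t + 1) =
            (s + 1 + t).choose t + (s + (t + 1)).choose (t + 1) := by
          rw [show s + 1 + (t + 1) = (s + 1 + t) + 1 by ring, Nat.choose_succ_succ,
            show s + 1 + t = s + (t + 1) by ring]
        omega

end Elimination

/-! ### Subtrees of a rooted tree. -/

section Tree

variable {ι : Type*} {T : SimpleGraph ι}

theorem Walk.dist_lt_of_mem_support {u v w : ι} (p : T.Walk u v) (hp : p.length = T.dist u v)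
    (hw : w ∈ p.support) (hne : w ≠ u) : T.dist w v < T.dist u v := by
  classical
  have h1 := congrArg Walk.length (p.take_spec hw)
  rw [Walk.length_append] at h1
  have h2 := dist_le (p.dropUntil w hw)
  have h3 : (p.takeUntil w hw).length ≠ 0 := fun h => hne (Walk.eq_of_length_eq_zero h).symm
  omega

theorem exists_isPath_of_induce_connected {S : Set ι} (hS : (T.induce S).Connected) {x s : ι}
    (hx : x ∈ S) (hs : s ∈ S) : ∃ p : T.Walk x s, p.IsPath ∧ ∀ u ∈ p.support, u ∈ S := by
  classical
  obtain ⟨p, hp⟩ := (hS ⟨x, hx⟩ ⟨s, hs⟩).exists_isPath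
  refine ⟨p.map (Embedding.induce (G := T) S).toHom, hp.map (f := (Embedding.induce (G := T) S).toHom) Subtype.val_injective, fun u hu => ?_⟩
  obtain ⟨v, -, rfl⟩ :=
    List.mem_map.1 ((Walk.support_map (Embedding.induce (G := T) S).toHom p) ▸ hu)
  exact v.2

/-- If two subtrees of a rooted tree meet, then the one whose highest vertex is higher contains
the highest vertex of the other one. -/
theorem IsTree.mem_of_dist_le (hT : T.IsTree) {S S' : Set ι} (hS : (T.induce S).Connected)
    (hS' : (T.induce S').Connected) {ρ x s s' : ι} (hx : x ∈ S) (hx' : x ∈ S') (hs : s ∈ S)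
    (hs' : s' ∈ S') (hmin : ∀ u ∈ S, T.dist s ρ ≤ T.dist u ρ) (h : T.dist s' ρ ≤ T.dist s ρ) :
    s ∈ S' := by
  classical
  obtain ⟨w, hw, hwS⟩ := exists_isPath_of_induce_connected hS hx hs
  obtain ⟨w', hw', hwS'⟩ := exists_isPath_of_induce_connected hS' hx' hs'
  obtain ⟨g, hg, hgl⟩ := hT.connected.exists_path_of_dist s ρ
  obtain ⟨g', hg', hgl'⟩ := hT.connected.exists_path_of_dist s' ρ
  have hpath : (w.append g).IsPath := by
    rw [Walk.isPath_def, Walk.support_append, List.nodup_append']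
    have hgn := g.cons_tail_support.symm ▸ hg.support_nodup
    refine ⟨hw.support_nodup, hgn.of_cons, fun u hu hu' => ?_⟩
    have hne : u ≠ s := by
      rintro rfl
      exact (List.nodup_cons.1 hgn).1 hu'
    have := g.dist_lt_of_mem_support hgl (List.mem_of_mem_tail hu') hne
    have := hmin u (hwS u hu)
    omega
  -- Both routes from `x` to the root are the same path, so `s` lies on the route through `s'`:
  -- before `s'` it is in `S'`, and strictly after `s'` it would be too close to the root.
  have heq := (hT.existsUnique_path x ρ).unique hpath (w'.append g').bypass_isPath
  have hsm : s ∈ (w.append g).support := by simp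
  rw [heq] at hsm
  rcases (Walk.mem_support_append_iff _ _).1 (Walk.support_bypass_subset_support _ hsm) with h1 | h1
  · exact hwS' _ h1
  · by_contra hne
    have hne' : s ≠ s' := fun h => hne (h ▸ hs')
    have := g'.dist_lt_of_mem_support hgl' h1 hne'
    omega

end Tree

/-! ### Tree-decompositions and treewidth. -/

theorem neg_one_le_width {V ι : Type*} [Fintype ι] {G : SimpleGraph V} {T : SimpleGraph ι}
    (D : TreeDecomposition G T) : -1 ≤ D.width := by
  unfold TreeDecomposition.width; omega

theorem width_le_iff {V ι : Type*} [Fintype ι] {G : SimpleGraph V} {T : SimpleGraph ι}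
    (D : TreeDecomposition G T) (k : ℕ) : D.width ≤ (k : ℤ) - 1 ↔ ∀ x, (D.bag x).card ≤ k := by
  rw [TreeDecomposition.width, sub_le_sub_iff_right, Nat.cast_le, Finset.sup_le_iff]
  simp

theorem treewidth_le_width {V : Type*} {ι : Type} [Fintype ι] {G : SimpleGraph V}
    {T : SimpleGraph ι} (D : TreeDecomposition G T) : G.treewidth ≤ D.width :=
  csInf_le ⟨-1, by rintro w ⟨ι, _, T, D, rfl⟩; exact neg_one_le_width D⟩ ⟨ι, ‹_›, T, D, rfl⟩

theorem exists_width_eq_treewidth {V : Type*} [Finite V] (G : SimpleGraph V) :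
    ∃ (ι : Type) (_ : Fintype ι) (T : SimpleGraph ι) (D : TreeDecomposition G T),
      D.width = G.treewidth := by
  have := Fintype.ofFinite V
  refine Int.csInf_mem (s := {w : ℤ | ∃ (ι : Type) (_ : Fintype ι) (T : SimpleGraph ι)
      (D : TreeDecomposition G T), D.width = w})
    ⟨_, Unit, inferInstance, ⊥, ⟨.of_subsingleton, fun _ => Finset.univ,
      fun v => ?_, fun u v _ => ⟨(), by simp, by simp⟩⟩, rfl⟩
    ⟨-1, by rintro w ⟨ι, _, T, D, rfl⟩; exact neg_one_le_width D⟩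
  have : Nonempty {x : Unit | v ∈ (Finset.univ : Finset V)} := ⟨(), by simp⟩
  exact IsTree.of_subsingleton.connected

theorem neg_one_le_treewidth {V : Type*} [Finite V] (G : SimpleGraph V) : -1 ≤ G.treewidth := by
  obtain ⟨ι, _, T, D, h⟩ := exists_width_eq_treewidth G
  exact h ▸ neg_one_le_width D

/-- Order vertices by the depth of their highest bag. Then all of `B i` lies in the highest bag of
`i`, which gives both chordality and the size bound. -/
theorem exists_elimination {V : Type*} [Finite V] (G : SimpleGraph V) {t : ℕ}
    (ht : G.treewidth ≤ t) :
    ∃ (n : ℕ) (e : V ≃ Fin n) (B : Fin n → Finset (Fin n)), IsElimination B ∧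
      (∀ i, (B i).card ≤ t) ∧ ∀ u v, G.Adj u v → e u ∈ B (e v) ∨ e v ∈ B (e u) := by
  classical
  obtain ⟨ι, _, T, D, hD⟩ := exists_width_eq_treewidth G
  have hw : ∀ x, (D.bag x).card ≤ t + 1 :=
    (width_le_iff D (t + 1)).1 (by push_cast; omega)
  obtain ⟨ρ⟩ := D.isTree.connected.nonempty
  have htop : ∀ v, ∃ s, v ∈ D.bag s ∧ ∀ u, v ∈ D.bag u → T.dist s ρ ≤ T.dist u ρ := fun v => by
    obtain ⟨x⟩ := (D.connected_bags v).nonempty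
    obtain ⟨s, hs, hmin⟩ := Set.exists_min_image {x | v ∈ D.bag x} (T.dist · ρ)
      (Set.toFinite _) ⟨x.1, x.2⟩
    exact ⟨s, hs, hmin⟩
  choose top htop hmin using htop
  obtain ⟨n, ⟨e₀⟩⟩ := Finite.exists_equiv_fin V
  let depth : Fin n → ℕ := fun i => T.dist (top (e₀.symm i)) ρ
  let e : V ≃ Fin n := e₀.trans (Tuple.sort depth).symm
  have hmono : ∀ i j, i ≤ j → T.dist (top (e.symm i)) ρ ≤ T.dist (top (e.symm j)) ρ :=
    Tuple.monotone_sort depth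
  let B : Fin n → Finset (Fin n) := fun i =>
    Finset.univ.filter fun j => j < i ∧ ∃ x, e.symm j ∈ D.bag x ∧ e.symm i ∈ D.bag x
  have hB : ∀ i, ∀ j ∈ B i, e.symm j ∈ D.bag (top (e.symm i)) := fun i j hj => by
    obtain ⟨-, hlt, x, hjx, hix⟩ := Finset.mem_filter.1 hj
    exact D.isTree.mem_of_dist_le (D.connected_bags (e.symm i)) (D.connected_bags (e.symm j))
      hix hjx (htop _) (htop _) (hmin _) (hmono _ _ hlt.le)
  refine ⟨n, e, B, ⟨fun i j hj => (Finset.mem_filter.1 hj).2.1, fun i j hj k hk hjk => ?_⟩,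
    fun i => ?_, fun u v huv => ?_⟩
  · exact Finset.mem_filter.2 ⟨Finset.mem_univ _, hjk, _, hB i j hj, hB i k hk⟩
  · have h1 : insert (e.symm i) ((B i).map e.symm.toEmbedding) ⊆ D.bag (top (e.symm i)) := by
      intro v hv
      rcases Finset.mem_insert.1 hv with rfl | hv
      · exact htop _
      · obtain ⟨j, hj, rfl⟩ := Finset.mem_map.1 hv
        exact hB i j hj
    have h2 := (Finset.card_le_card h1).trans (hw _)
    rw [Finset.card_insert_of_notMem, Finset.card_map] at h2
    · omega
    · simp [B]
  · obtain ⟨x, hu, hv⟩ := D.exists_bag_of_adj u v huv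
    rcases lt_trichotomy (e u) (e v) with h | h | h
    · exact Or.inl (Finset.mem_filter.2 ⟨Finset.mem_univ _, h, x, by simpa using ⟨hu, hv⟩⟩)
    · exact absurd (e.injective h) huv.ne
    · exact Or.inr (Finset.mem_filter.2 ⟨Finset.mem_univ _, h, x, by simpa using ⟨hv, hu⟩⟩)

/-- The tree with root `0` in which `parent i` is the parent of `i + 1`. -/
def parentTree {n : ℕ} (parent : Fin n → Fin (n + 1)) : SimpleGraph (Fin (n + 1)) :=
  fromEdgeSet (Set.range fun i => s(i.succ, parent i))

theorem parentTree_adj {n : ℕ} {parent : Fin n → Fin (n + 1)} (h : ∀ i, parent i < i.succ)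
    (i : Fin n) : (parentTree parent).Adj i.succ (parent i) := by
  rw [parentTree, fromEdgeSet_adj]
  exact ⟨⟨i, rfl⟩, (h i).ne'⟩

theorem isTree_parentTree {n : ℕ} {parent : Fin n → Fin (n + 1)} (h : ∀ i, parent i < i.succ) :
    (parentTree parent).IsTree := by
  have hconn : (parentTree parent).Connected := by
    rw [connected_iff_exists_forall_reachable]
    refine ⟨0, fun i => Reachable.symm ?_⟩
    induction i using WellFoundedLT.induction with
    | ind i ih =>
      cases i using Fin.cases with
      | zero => exact Reachable.refl _
      | succ i => exact (parentTree_adj h i).reachable.trans (ih _ (h i))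
  rw [isTree_iff_connected_and_card]
  refine ⟨hconn, le_antisymm ?_ hconn.card_vert_le_card_edgeSet_add_one⟩
  rw [Nat.card_eq_fintype_card (α := Fin (n + 1)), Fintype.card_fin]
  refine Nat.succ_le_succ ?_
  calc Nat.card (parentTree parent).edgeSet
      ≤ Nat.card (Set.range fun i => s(i.succ, parent i)) :=
        Nat.card_mono (Set.toFinite _) (by simp [parentTree])
    _ ≤ Nat.card (Fin n) := Finite.card_range_le _
    _ = n := by simp

/-- A graph whose edges are covered by bags, one for each vertex, such that each bag without
its own vertex is contained in an earlier bag, has small treewidth. -/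
theorem treewidth_le_of_bags {n k : ℕ} (J : SimpleGraph (Fin n)) (C : Fin n → Finset (Fin n))
    (hself : ∀ i, i ∈ C i) (hk : ∀ i, (C i).card ≤ k)
    (hparent : ∀ i, C i = {i} ∨ ∃ p < i, ∀ z ∈ C i, z ≠ i → z ∈ C p)
    (hJ : ∀ i j, J.Adj i j → ∃ x, i ∈ C x ∧ j ∈ C x) : J.treewidth ≤ (k : ℤ) - 1 := by
  -- The extra root with empty bag joins the forest of parents into one tree and covers `n = 0`.
  let bag : Fin (n + 1) → Finset (Fin n) := Fin.cases ∅ C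
  have hp : ∀ i : Fin n, ∃ p : Fin (n + 1), p < i.succ ∧ ∀ z ∈ C i, z ≠ i → z ∈ bag p := by
    intro i
    rcases hparent i with h | ⟨p, hp, h⟩
    · exact ⟨0, Fin.succ_pos i, fun z hz hzi => absurd (by simpa [h] using hz) hzi⟩
    · exact ⟨p.succ, Fin.succ_lt_succ_iff.2 hp, h⟩
  choose parent hlt hsub using hp
  let D : TreeDecomposition J (parentTree parent) :=
    { isTree := isTree_parentTree hlt
      bag := bag
      connected_bags := fun v => by
        rw [connected_iff_exists_forall_reachable]
        refine ⟨⟨v.succ, hself v⟩, fun ⟨i, hi⟩ => Reachable.symm ?_⟩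
        induction i using WellFoundedLT.induction with
        | ind i ih =>
          cases i using Fin.cases with
          | zero => exact absurd hi (Finset.notMem_empty v)
          | succ i =>
            by_cases h : v = i
            · subst h; exact Reachable.refl _
            · have hv := hsub i v hi h
              refine Reachable.trans ?_ (ih (parent i) (hlt i) hv)
              exact Adj.reachable (G := (parentTree parent).induce {x | v ∈ bag x})
                (u := ⟨i.succ, hi⟩) (v := ⟨parent i, hv⟩) (parentTree_adj hlt i)
      exists_bag_of_adj := fun u v huv => by
        obtain ⟨x, hx⟩ := hJ u v huv
        exact ⟨x.succ, hx⟩ }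
  refine (treewidth_le_width D).trans ((width_le_iff D k).2 fun x => ?_)
  cases x using Fin.cases with
  | zero => exact Nat.zero_le _
  | succ i => exact hk i

theorem treewidth_strongProd_completeGraph_le {V : Type*} [Finite V] (G : SimpleGraph V) (m k : ℕ)
    (hG : G.treewidth ≤ (k : ℤ) - 1) :
    (G.strongProd (completeGraph (Fin m))).treewidth ≤ (k : ℤ) * m - 1 := by
  obtain ⟨ι, _, T, D, hD⟩ := exists_width_eq_treewidth G
  let D' : TreeDecomposition (G.strongProd (completeGraph (Fin m))) T :=
    { isTree := D.isTree
      bag := fun x => D.bag x ×ˢ Finset.univ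
      connected_bags := fun v => by
        have h : {x | v ∈ D.bag x ×ˢ Finset.univ} = {x | v.1 ∈ D.bag x} := by ext; simp
        rw [h]
        exact D.connected_bags v.1
      exists_bag_of_adj := by
        rintro ⟨u, i⟩ ⟨v, j⟩ (⟨h, -⟩ | ⟨h, -⟩)
        · obtain ⟨x, hx⟩ := D.exists_bag_of_adj u v h
          exact ⟨x, by simpa using hx⟩
        · obtain ⟨x⟩ := (D.connected_bags u).nonempty
          obtain rfl : u = v := h
          exact ⟨x.1, by simpa using Set.mem_ofPred.1 x.2⟩ }
  have hw := (width_le_iff D k).1 (hD ▸ hG)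
  refine (treewidth_le_width D').trans ?_
  rw [← Nat.cast_mul, width_le_iff]
  intro x
  simpa [D'] using Nat.mul_le_mul_right m (hw x)

theorem rowTreewidth_le {V : Type*} {α β : Type} [Finite α] {G : SimpleGraph V}
    {H : SimpleGraph α} {P : SimpleGraph β} (hP : P.IsPathGraph)
    (h : G.IsContained (H.strongProd P)) : G.rowTreewidth ≤ H.treewidth :=
  csInf_le ⟨-1, by rintro w ⟨α, _, H, β, P, -, -, rfl⟩; exact neg_one_le_treewidth H⟩
    ⟨α, ‹_›, H, β, P, hP, h, rfl⟩

/-! ### Strong products, branch sets and the embedding. -/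

theorem strongProd_adj_iff {α β : Type*} {G : SimpleGraph α} {H : SimpleGraph β} {x y : α × β} :
    (G.strongProd H).Adj x y ↔
      x ≠ y ∧ (x.1 = y.1 ∨ G.Adj x.1 y.1) ∧ (x.2 = y.2 ∨ H.Adj x.2 y.2) := by
  rcases x with ⟨a, b⟩
  rcases y with ⟨c, d⟩
  have h1 : G.Adj a c → a ≠ c := Adj.ne
  have h2 : H.Adj b d → b ≠ d := Adj.ne
  simp only [strongProd, ne_eq, Prod.mk.injEq]
  tauto

/-- A connected subgraph of radius at most `r` has a centre that is joined to each vertex by a walk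
of length at most `r` in the subgraph. -/
theorem Subgraph.exists_center {V : Type*} [Finite V] {G : SimpleGraph V} {K : G.Subgraph}
    (hK : K.Connected) {r : ℕ} (hr : K.coe.radius ≤ r) :
    ∃ c ∈ K.verts, ∀ x ∈ K.verts, ∃ p : G.Walk c x, p.length ≤ r ∧
      ∀ u ∈ p.support, u ∈ K.verts := by
  have := hK.nonempty.to_subtype
  obtain ⟨c, hc⟩ := K.coe.exists_eccent_eq_radius
  refine ⟨c, c.2, fun x hx => ?_⟩
  have hd : K.coe.edist c ⟨x, hx⟩ ≤ r := (edist_le_eccent.trans hc.le).trans hr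
  obtain ⟨p, hp⟩ := hK.coe.exists_walk_length_eq_edist c ⟨x, hx⟩
  rw [← hp, Nat.cast_le] at hd
  refine ⟨p.map K.hom, (Walk.length_map _ _).trans_le hd, fun u hu => ?_⟩
  obtain ⟨v, -, rfl⟩ := List.mem_map.1 (Walk.support_map K.hom p ▸ hu)
  exact v.2

theorem IsElimination.mem_descend_of_walk {W α : Type*} [LinearOrder α] {B : α → Finset α}
    (hB : IsElimination B) {Q : SimpleGraph W} {f : W → α}
    (hf : ∀ x y, Q.Adj x y → f x = f y ∨ f x ∈ B (f y) ∨ f y ∈ B (f x)) {z : α} {s : ℕ} {x y : W}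
    (p : Q.Walk x y) (hp : ∀ u ∈ p.support, z ≤ f u) (hz : z ∈ descend B s (f y)) :
    z ∈ descend B (s + p.length) (f x) := by
  induction p with
  | nil => exact hz
  | @cons u v w h p ih =>
    have := ih (fun u hu => hp u (List.mem_cons_of_mem _ hu)) hz
    exact hB.mem_descend_succ_of_adj (hf _ _ h.symm) this (hp u (Walk.start_mem_support _))

theorem Walk.abs_sub_le_length {W : Type*} {Q : SimpleGraph W} {g : W → ℤ}
    (hg : ∀ x y, Q.Adj x y → |g x - g y| ≤ 1) {x y : W} (p : Q.Walk x y) :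
    |g x - g y| ≤ p.length := by
  induction p with
  | nil => simp
  | @cons u v w h p ih =>
    have := hg _ _ h
    rw [Walk.length_cons]
    push_cast
    rw [abs_le] at *
    constructor <;> linarith

/-- Two branch sets joined by an edge, with `f`-minimal vertices `a` and `a'`: some vertex weakly
reaches both `f a` and `f a'` within `2 * r + 1` steps, and `a` and `a'` are close. -/
theorem exists_descend_of_adj_branchSets {W α : Type*} [Finite W] [LinearOrder α]
    {B : α → Finset α} (hB : IsElimination B) {Q : SimpleGraph W} {f : W → α}
    (hf : ∀ x y, Q.Adj x y → f x = f y ∨ f x ∈ B (f y) ∨ f y ∈ B (f x)) {r : ℕ}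
    {K K' : Q.Subgraph} (hK : K.Connected) (hK' : K'.Connected) (hr : K.coe.radius ≤ r)
    (hr' : K'.coe.radius ≤ r) {a a' : W} (ha : a ∈ K.verts) (ha' : a' ∈ K'.verts)
    (hmin : ∀ u ∈ K.verts, f a ≤ f u) (hmin' : ∀ u ∈ K'.verts, f a' ≤ f u) {x x' : W}
    (hx : x ∈ K.verts) (hx' : x' ∈ K'.verts) (hadj : Q.Adj x x') :
    (∃ y, f a ∈ descend B (2 * r + 1) y ∧ f a' ∈ descend B (2 * r + 1) y) ∧
      ∃ p : Q.Walk a a', p.length ≤ 4 * r + 1 := by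
  have key : ∀ {K : Q.Subgraph}, K.Connected → K.coe.radius ≤ r → ∀ {a x}, a ∈ K.verts →
      x ∈ K.verts → ∃ p : Q.Walk x a, p.length ≤ 2 * r ∧ ∀ u ∈ p.support, u ∈ K.verts := by
    intro K hK hr a x ha hx
    obtain ⟨c, -, h⟩ := Subgraph.exists_center hK hr
    obtain ⟨p, hp, hpK⟩ := h a ha
    obtain ⟨q, hq, hqK⟩ := h x hx
    refine ⟨q.reverse.append p, by simp; omega, fun u hu => ?_⟩
    rcases (Walk.mem_support_append_iff _ _).1 hu with hu | hu
    · exact hqK u (by simpa using hu)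
    · exact hpK u hu
  obtain ⟨p, hp, hpK⟩ := key hK hr ha hx
  obtain ⟨p', hp', hpK'⟩ := key hK' hr' ha' hx'
  have hd : f a ∈ descend B (2 * r) (f x) := descend_mono (by omega) _
    (hB.mem_descend_of_walk hf p (fun u hu => hmin u (hpK u hu)) (self_mem_descend 0 _))
  have hd' : f a' ∈ descend B (2 * r) (f x') := descend_mono (by omega) _
    (hB.mem_descend_of_walk hf p' (fun u hu => hmin' u (hpK' u hu)) (self_mem_descend 0 _))
  refine ⟨?_, p.reverse.append (Walk.cons hadj p'), by simp; omega⟩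
  -- The smaller minimum bounds both branch sets from below, so its descent extends across the edge.
  rcases le_total (f a) (f a') with h | h
  · exact ⟨f x', hB.mem_descend_succ_of_adj (hf _ _ hadj) hd (h.trans (hmin' _ hx')),
      descend_subset_succ _ _ hd'⟩
  · exact ⟨f x, descend_subset_succ _ _ hd,
      hB.mem_descend_succ_of_adj (hf _ _ hadj.symm) hd' (h.trans (hmin _ hx))⟩

theorem exists_isContained_strongProd {V α β : Type*} [Finite V] [Finite α] [Finite β]
    (G : SimpleGraph V) (H : SimpleGraph α) (P : SimpleGraph β) (r t ℓ : ℕ)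
    (hP : P.IsPathGraph) (hH : H.treewidth ≤ (t : ℤ))
    (hG : IsShallowMinor r G ((H.strongProd P).strongProd (completeGraph (Fin ℓ)))) :
    ∃ (n : ℕ) (J : SimpleGraph (Fin n)), J.treewidth ≤ ((2 * r + 1 + t).choose t : ℤ) - 1 ∧
      G.IsContained
        ((J.strongProd P).strongProd (completeGraph (Fin (ℓ * (2 * r + 1) ^ 2)))) := by
  obtain ⟨n, e, B, hB, hcard, hadj⟩ := exists_elimination H hH
  obtain ⟨N, ⟨φ⟩⟩ := hP
  obtain ⟨μ, hμ, hrad⟩ := hG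
  let J : SimpleGraph (Fin n) := fromRel fun i j =>
    ∃ y, i ∈ descend B (2 * r + 1) y ∧ j ∈ descend B (2 * r + 1) y
  have hJ : J.treewidth ≤ ((2 * r + 1 + t).choose t : ℤ) - 1 :=
    treewidth_le_of_bags J (descend B (2 * r + 1)) (self_mem_descend _)
      (hB.card_descend_le hcard _) (hB.exists_parent _) fun i j hij => by
        obtain ⟨-, ⟨y, h⟩ | ⟨y, h⟩⟩ := (fromRel_adj _ _ _).1 hij
        · exact ⟨y, h⟩
        · exact ⟨y, h.symm⟩
  refine ⟨n, J, hJ, ?_⟩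
  let f : (α × β) × Fin ℓ → Fin n := fun x => e x.1.1
  let g : (α × β) × Fin ℓ → ℤ := fun x => (φ x.1.2).val
  have hf : ∀ x y, ((H.strongProd P).strongProd (completeGraph (Fin ℓ))).Adj x y →
      f x = f y ∨ f x ∈ B (f y) ∨ f y ∈ B (f x) := by
    intro x y h
    obtain ⟨-, h | h, -⟩ := strongProd_adj_iff.1 h
    · exact Or.inl (by simp [f, h])
    · obtain ⟨-, h | h, -⟩ := strongProd_adj_iff.1 h
      · exact Or.inl (by simp [f, h])
      · exact Or.inr (hadj _ _ h)
  have hg : ∀ x y, ((H.strongProd P).strongProd (completeGraph (Fin ℓ))).Adj x y →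
      |g x - g y| ≤ 1 := by
    intro x y h
    obtain ⟨-, h | h, -⟩ := strongProd_adj_iff.1 h
    · simp [g, h]
    · obtain ⟨-, -, h | h⟩ := strongProd_adj_iff.1 h
      · simp [g, h]
      · have := pathGraph_adj.1 (φ.map_adj_iff.2 h)
        simp only [g]
        rw [abs_le]
        omega
  have hmin : ∀ v, ∃ a ∈ (μ v).verts, ∀ u ∈ (μ v).verts, f a ≤ f u := fun v =>
    Set.exists_min_image _ f (Set.toFinite _) (hμ.connected v).nonempty
  choose a ha hamin using hmin
  have hainj : Function.Injective a := fun v w h => by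
    by_contra hne
    exact Set.disjoint_left.1 (hμ.disjoint v w hne) (ha v) (h ▸ ha w)
  -- Only `4 * r + 1 ≤ m` is needed, so that neighbours land in equal or consecutive blocks.
  set m := (2 * r + 1) ^ 2 with hm
  have hm0 : 0 < m := by positivity
  let pos : V → ℕ := fun v => (φ (a v).1.2).val
  let block : V → Fin (N + 1) := fun v =>
    ⟨pos v / m, (Nat.div_le_self _ _).trans_lt (φ (a v).1.2).isLt⟩
  let F : V → (Fin n × β) × Fin (ℓ * m) := fun v =>
    ((f (a v), φ.symm (block v)), finProdFinEquiv ((a v).2, ⟨pos v % m, Nat.mod_lt _ hm0⟩))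
  have hF : Function.Injective F := by
    intro v w h
    simp only [F, Prod.mk.injEq, EmbeddingLike.apply_eq_iff_eq, Fin.mk.injEq, block, f] at h
    obtain ⟨⟨h1, h2⟩, h3, h4⟩ := h
    have h5 : pos v = pos w := by
      rw [← Nat.div_add_mod (pos v) m, ← Nat.div_add_mod (pos w) m, h2, h4]
    have h6 : (a v).1.2 = (a w).1.2 := φ.injective (Fin.ext h5)
    exact hainj (Prod.ext (Prod.ext h1 h6) h3)
  refine ⟨Hom.toCopy ⟨F, fun {v w} hvw => ?_⟩ hF⟩
  obtain ⟨x, hx, x', hx', hxx'⟩ := hμ.adjacent v w hvw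
  obtain ⟨⟨y, hy⟩, p, hp⟩ := exists_descend_of_adj_branchSets hB hf (hμ.connected v)
    (hμ.connected w) (hrad v) (hrad w) (ha v) (ha w) (hamin v) (hamin w) hx hx' hxx'
  have hblock : (block v).val = block w ∨ (block v).val + 1 = block w ∨
      (block w).val + 1 = block v := by
    have h1 : |(pos v : ℤ) - pos w| ≤ m := by
      refine (p.abs_sub_le_length hg).trans ?_
      exact_mod_cast hp.trans (by rw [hm]; nlinarith)
    rw [abs_le] at h1
    have h2 : pos v / m ≤ pos w / m + 1 := by
      rw [← Nat.add_div_right _ hm0]; exact Nat.div_le_div_right (by omega)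
    have h3 : pos w / m ≤ pos v / m + 1 := by
      rw [← Nat.add_div_right _ hm0]; exact Nat.div_le_div_right (by omega)
    simp only [block]
    omega
  have hne : F v ≠ F w := fun h => hvw.ne (hF h)
  have hJ' : f (a v) = f (a w) ∨ J.Adj (f (a v)) (f (a w)) := by
    refine or_iff_not_imp_left.2 fun h => (fromRel_adj _ _ _).2 ⟨h, Or.inl ⟨y, hy⟩⟩
  have hP' : φ.symm (block v) = φ.symm (block w) ∨
      P.Adj (φ.symm (block v)) (φ.symm (block w)) := by
    rcases hblock with h | h
    · exact Or.inl (congrArg _ (Fin.ext h))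
    · exact Or.inr (φ.symm.map_adj_iff.2 (pathGraph_adj.2 h))
  -- Adjacency in the complete graph is inequality, hence `em`.
  refine strongProd_adj_iff.2 ⟨hne, ?_, em _⟩
  refine or_iff_not_imp_left.2 fun h => strongProd_adj_iff.2 ⟨h, hJ', hP'⟩

theorem IsContained.strongProd_right_comm {V γ β δ ε : Type*} {G : SimpleGraph V}
    {J : SimpleGraph γ} {P : SimpleGraph β} {P' : SimpleGraph ε} {K : SimpleGraph δ} (φ : P ≃g P')
    (h : G.IsContained ((J.strongProd P).strongProd K)) :
    G.IsContained ((J.strongProd K).strongProd P') := by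
  let F : (γ × β) × δ → (γ × δ) × ε := fun x => ((x.1.1, x.2), φ x.1.2)
  have hF : Function.Injective F := by
    rintro ⟨⟨x, y⟩, z⟩ ⟨⟨x', y'⟩, z'⟩ h
    simp_all [F]
  refine h.trans ⟨Hom.toCopy ⟨F, fun {x y} hxy => ?_⟩ hF⟩
  obtain ⟨hne, h1, h2⟩ := strongProd_adj_iff.1 hxy
  have h3 : (x.1.1 = y.1.1 ∨ J.Adj x.1.1 y.1.1) ∧ (x.1.2 = y.1.2 ∨ P.Adj x.1.2 y.1.2) := by
    rcases h1 with h1 | h1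
    · simp [h1]
    · exact (strongProd_adj_iff.1 h1).2
  refine strongProd_adj_iff.2 ⟨hF.ne hne, ?_, h3.2.imp (congrArg φ) φ.map_adj_iff.2⟩
  exact or_iff_not_imp_left.2 fun h => strongProd_adj_iff.2 ⟨h, h3.1, h2⟩

end SimpleGraph

theorem mainTheorem2 {V α β : Type*} [Finite V] [Finite α] [Finite β]
    (G : SimpleGraph V) (H : SimpleGraph α) (P : SimpleGraph β) (r t ℓ : ℕ)
    (hP : P.IsPathGraph) (hH : H.treewidth ≤ (t : ℤ))
    (hG : SimpleGraph.IsShallowMinor r G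
      ((H.strongProd P).strongProd (SimpleGraph.completeGraph (Fin ℓ)))) :
    (∃ (γ : Type) (_ : Finite γ) (J : SimpleGraph γ),
      J.treewidth ≤ ((2 * r + 1 + t).choose t : ℤ) - 1 ∧
      G.IsContained
        ((J.strongProd P).strongProd (SimpleGraph.completeGraph (Fin (ℓ * (2 * r + 1) ^ 2))))) ∧
    G.rowTreewidth ≤ ((2 * r + 1 + t).choose t : ℤ) * (ℓ * (2 * r + 1) ^ 2) - 1 := by
  obtain ⟨n, J, hJ, hGJ⟩ := SimpleGraph.exists_isContained_strongProd G H P r t ℓ hP hH hG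
  refine ⟨⟨Fin n, inferInstance, J, hJ, hGJ⟩, ?_⟩
  obtain ⟨N, ⟨φ⟩⟩ := hP
  refine (SimpleGraph.rowTreewidth_le ⟨N, ⟨SimpleGraph.Iso.refl⟩⟩
    (hGJ.strongProd_right_comm φ)).trans ?_
  exact_mod_cast SimpleGraph.treewidth_strongProd_completeGraph_le J (ℓ * (2 * r + 1) ^ 2) _ hJ
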